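/- All rings are associative with unity, not necessarily commutative. A right $R$-module $M$ is called isoartinian if for every descending chain $M_0\supseteq M_1\supseteq M_2\supseteq\cdots$ of submodules of $M$ there is an index $n$ such that $M_n\cong M_i$ for all $i\ge n$; a ring $R$ is right isoartinian if the right module $R_R$ is isoartinian. A principal right ideal domain is a nonzero ring $D$ without zero divisors in which every right ideal is of the form $aD$ with $a\in D$. Let $R$ be a nonzero simple ring. The following statements are equivalent: 1. $R$ is right isoartinian; 2. $R\cong \mathbb{M}_n(D)$ (as rings) for some integer $n\ge 1$ and some simple principal right ideal domain $D$. Moreover, if $R\cong\mathbb{M}_n(D)$ with $n\ge 1$ and $D$ a division ring, then $R$ is simple artinian; in particular, $R$ is right artinian and right noetherian. -/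

import Mathlib

universe u v

/-- A module is isoartinian if every descending chain of submodules
`M₀ ≥ M₁ ≥ M₂ ≥ ⋯` stabilizes up to isomorphism. -/
def IsIsoartinian (R M : Type*) [Ring R] [AddCommGroup M] [Module R M] : Prop :=
  ∀ f : ℕ → Submodule R M, Antitone f → ∃ n : ℕ, ∀ i : ℕ, n ≤ i → Nonempty (f n ≃ₗ[R] f i)

/-- Right `R`-modules are modules over `Rᵐᵒᵖ`; the right ideals of `R` are the
`Rᵐᵒᵖ`-submodules of `R`. -/
def IsRightIsoartinianRing (R : Type*) [Ring R] : Prop :=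
  IsIsoartinian Rᵐᵒᵖ R

/-- A principal right ideal domain: a (nonzero, not necessarily commutative) domain in which
every right ideal has the form `aD`. -/
structure IsPrincipalRightIdealDomain (D : Type*) [Ring D] : Prop where
  isDomain : IsDomain D
  principal : ∀ I : Submodule Dᵐᵒᵖ D, ∃ a : D, ∀ x : D, x ∈ I ↔ ∃ r : D, x = a * r

/-! An isoartinian ring `R` contains an isosimple right ideal `U`. By simplicity `R` embeds in some
power of `U`; for a minimal exponent `k`, `U^k` embeds back in `R`, and mutual embeddability forces
`R ≅ U^k`. So `U` is projective and `R` is the `k × k` matrix ring over `End U`. Nonzero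
endomorphisms of `U` are injective, so `End U` is a domain; as `U` is noetherian and projective, an
element of maximal image generates a given right ideal. Conversely, over a principal right ideal
domain `D` submodules of `D^n` are free, and their ranks stabilize along a descending chain. Taking
columns carries this to right ideals of the matrix ring. -/

/-- A module is isosimple if it is nonzero and isomorphic to each of its nonzero submodules. -/
structure IsIsosimple (R M : Type*) [Ring R] [AddCommGroup M] [Module R M] : Prop where
  nontrivial : Nontrivial M
  nonempty_equiv : ∀ N : Submodule R M, N ≠ ⊥ → Nonempty (N ≃ₗ[R] M)

/-! ### Isoartinian modules -/

namespace IsIsoartinian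

variable {R M N : Type*} [Ring R] [AddCommGroup M] [Module R M] [AddCommGroup N] [Module R N]

/-- Mutually embeddable modules are isomorphic as soon as one of them is isoartinian. -/
theorem nonempty_equiv_of_injective (h : IsIsoartinian R M) (i : M →ₗ[R] N) (j : N →ₗ[R] M)
    (hi : Function.Injective i) (hj : Function.Injective j) : Nonempty (M ≃ₗ[R] N) := by
  let c : Module.End R M := j ∘ₗ i
  have hc : Function.Injective c := hj.comp hi
  have hcn (n : ℕ) : Function.Injective (c ^ n) := by
    rw [Module.End.coe_pow]
    exact hc.iterate n
  -- The chain `M ⊇ j(N) ⊇ c(M) ⊇ c(j(N)) ⊇ ⋯` alternates copies of `M` and `N`.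
  let f : ℕ → Submodule R M := fun n ↦
    if Even n then LinearMap.range (c ^ (n / 2)) else (LinearMap.range j).map (c ^ (n / 2))
  have hf : Antitone f := by
    refine antitone_nat_of_succ_le fun n ↦ ?_
    rcases Nat.even_or_odd' n with ⟨m, rfl | rfl⟩
    · have h1 : (2 * m + 1) / 2 = m := by omega
      have h2 : 2 * m / 2 = m := by omega
      have h3 : ¬ Even (2 * m + 1) := by simp
      simp only [f, h1, h2, if_neg h3, if_pos (even_two_mul m)]
      exact LinearMap.map_le_range
    · have h1 : (2 * m + 1) / 2 = m := by omega
      have h2 : (2 * m + 1 + 1) / 2 = m + 1 := by omega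
      have h3 : ¬ Even (2 * m + 1) := by simp
      have h4 : Even (2 * m + 1 + 1) := ⟨m + 1, by omega⟩
      simp only [f, h1, h2, if_neg h3, if_pos h4]
      rintro _ ⟨x, rfl⟩
      exact ⟨c x, ⟨i x, rfl⟩, by rw [pow_succ]; rfl⟩
  obtain ⟨n, hn⟩ := h f hf
  obtain ⟨e₁⟩ := hn (2 * n) (by omega)
  obtain ⟨e₂⟩ := hn (2 * n + 1) (by omega)
  have h1 : (2 * n + 1) / 2 = n := by omega
  have h3 : ¬ Even (2 * n + 1) := by simp
  have g₁ : f (2 * n) = LinearMap.range (c ^ n) := by simp [f]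
  have g₂ : f (2 * n + 1) = (LinearMap.range j).map (c ^ n) := by
    simp only [f, h1, if_neg h3]
  exact ⟨(LinearEquiv.ofInjective (c ^ n) (hcn n)).trans <|
    (LinearEquiv.ofEq _ _ g₁.symm).trans <| (e₁.symm.trans e₂).trans <|
    (LinearEquiv.ofEq _ _ g₂).trans <|
    (Submodule.equivMapOfInjective (c ^ n) (hcn n) (LinearMap.range j)).symm.trans
    (LinearEquiv.ofInjective j hj).symm⟩

/-- A nonzero isoartinian module has an isosimple submodule. -/
theorem exists_isIsosimple [Nontrivial M] (h : IsIsoartinian R M) :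
    ∃ U : Submodule R M, IsIsosimple R U := by
  by_contra! hU
  have step (V : {V : Submodule R M // V ≠ ⊥}) :
      ∃ W : {W : Submodule R M // W ≠ ⊥}, W.1 ≤ V.1 ∧ IsEmpty (V.1 ≃ₗ[R] W.1) := by
    by_contra! hV
    refine hU V.1 ⟨Submodule.nontrivial_iff_ne_bot.2 V.2, fun N hN ↦ ?_⟩
    have hN' : N.map V.1.subtype ≠ ⊥ := by
      intro hbot
      refine hN (Submodule.map_injective_of_injective V.1.injective_subtype ?_)
      rw [hbot, Submodule.map_bot]
    obtain ⟨e⟩ := hV ⟨_, hN'⟩ (Submodule.map_subtype_le _ _)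
    exact ⟨(Submodule.equivMapOfInjective _ V.1.injective_subtype N).trans e.symm⟩
  choose g hg hg' using step
  let s : ℕ → {V : Submodule R M // V ≠ ⊥} := fun n ↦ g^[n] ⟨⊤, top_ne_bot⟩
  have hs (n : ℕ) : s (n + 1) = g (s n) := Function.iterate_succ_apply' _ _ _
  obtain ⟨n, hn⟩ := h (fun n ↦ (s n).1) (antitone_nat_of_succ_le fun n ↦ by
    rw [hs]
    exact hg _)
  obtain ⟨e⟩ := hn (n + 1) n.le_succ
  have := hg' (s n)
  rw [← hs] at this
  exact this.false e

end IsIsoartinian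

/-! ### Isosimple modules and their endomorphism rings -/

namespace IsIsosimple

variable {R U : Type*} [Ring R] [AddCommGroup U] [Module R U]

/-- A nonzero cyclic submodule is a copy of `U`, so `U` and all its nonzero submodules are cyclic.
-/
theorem isNoetherian (h : IsIsosimple R U) : IsNoetherian R U := by
  have := h.nontrivial
  obtain ⟨u, hu⟩ := exists_ne (0 : U)
  obtain ⟨e⟩ := h.nonempty_equiv (Submodule.span R {u}) (by simpa using hu)
  have hfin : Module.Finite R U := Module.Finite.equiv e
  refine ⟨fun N ↦ ?_⟩
  by_cases hN : N = ⊥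
  · rw [hN]
    exact Submodule.fg_bot
  · obtain ⟨e'⟩ := h.nonempty_equiv N hN
    have : Module.Finite R N := Module.Finite.equiv e'.symm
    exact Module.Finite.iff_fg.1 this

/-- The image is a copy of `U`, so `f` yields a surjective endomorphism of a noetherian module. -/
theorem injective_of_ne_zero (h : IsIsosimple R U) {f : Module.End R U} (hf : f ≠ 0) :
    Function.Injective f := by
  have := h.isNoetherian
  obtain ⟨e⟩ := h.nonempty_equiv (LinearMap.range f) (by rwa [Ne, LinearMap.range_eq_bot])
  have := IsNoetherian.injective_of_surjective_endomorphism (e.toLinearMap ∘ₗ f.rangeRestrict)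
    (e.surjective.comp f.surjective_rangeRestrict)
  intro x y hxy
  apply this
  have : f.rangeRestrict x = f.rangeRestrict y := Subtype.ext hxy
  simp [this]

theorem isDomain_end (h : IsIsosimple R U) : IsDomain (Module.End R U) := by
  have := h.nontrivial
  have : NoZeroDivisors (Module.End R U) := by
    refine ⟨fun {f g} hfg ↦ or_iff_not_imp_left.2 fun hf ↦ LinearMap.ext fun x ↦ ?_⟩
    apply h.injective_of_ne_zero hf
    rw [← Module.End.mul_apply, hfg]
    simp
  exact NoZeroDivisors.to_isDomain _

/-- A nonzero sum of images is a copy of `U`, and projectivity lifts this copy through `U × U`.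
Hence a maximal image within a right ideal is the largest one. -/
theorem exists_range_eq_sup (h : IsIsosimple R U) [Module.Projective R U] (a b : Module.End R U) :
    ∃ g k : Module.End R U,
      LinearMap.range (a * g + b * k) = LinearMap.range a ⊔ LinearMap.range b := by
  by_cases hV : LinearMap.range a ⊔ LinearMap.range b = ⊥
  · exact ⟨0, 0, by simp [hV]⟩
  obtain ⟨e⟩ := h.nonempty_equiv _ hV
  let q : U × U →ₗ[R] U := a.coprod b
  have hq : LinearMap.range q = LinearMap.range a ⊔ LinearMap.range b := LinearMap.range_coprod a b
  obtain ⟨l, hl⟩ := Module.projective_lifting_property q.rangeRestrict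
    ((LinearEquiv.ofEq _ _ hq.symm).toLinearMap ∘ₗ e.symm.toLinearMap) q.surjective_rangeRestrict
  refine ⟨LinearMap.fst R U U ∘ₗ l, LinearMap.snd R U U ∘ₗ l, ?_⟩
  have key (x : U) : (a * (LinearMap.fst R U U ∘ₗ l) + b * (LinearMap.snd R U U ∘ₗ l)) x
      = (e.symm x : U) := congrArg Subtype.val (LinearMap.congr_fun hl x)
  ext y
  constructor
  · rintro ⟨x, rfl⟩
    rw [key]
    exact (e.symm x).2
  · intro hy
    exact ⟨e ⟨y, hy⟩, by rw [key]; simp⟩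

theorem isPrincipalRightIdealDomain_end (h : IsIsosimple R U) [Module.Projective R U] :
    IsPrincipalRightIdealDomain (Module.End R U) := by
  refine ⟨h.isDomain_end, fun I ↦ ?_⟩
  have := h.isNoetherian
  have hmul {a : Module.End R U} (ha : a ∈ I) (r : Module.End R U) : a * r ∈ I :=
    I.smul_mem (MulOpposite.op r) ha
  obtain ⟨_, ⟨a, ha, rfl⟩, hmax⟩ := set_has_maximal_iff_noetherian.2 this
    ((fun a : Module.End R U ↦ LinearMap.range a) '' (I : Set (Module.End R U)))
    ⟨_, 0, I.zero_mem, rfl⟩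
  refine ⟨a, fun x ↦ ⟨fun hx ↦ ?_, ?_⟩⟩
  · obtain ⟨g, k, hgk⟩ := h.exists_range_eq_sup a x
    have hle : LinearMap.range x ≤ LinearMap.range a := by
      by_contra hlt
      refine hmax _ ⟨_, I.add_mem (hmul ha g) (hmul hx k), rfl⟩ ?_
      simp only [hgk]
      exact left_lt_sup.2 hlt
    obtain ⟨r, hr⟩ := Module.projective_lifting_property a.rangeRestrict
      (x.codRestrict (LinearMap.range a) fun u ↦ hle ⟨u, rfl⟩) a.surjective_rangeRestrict
    exact ⟨r, LinearMap.ext fun u ↦ (congrArg Subtype.val (LinearMap.congr_fun hr u)).symm⟩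
  · rintro ⟨r, rfl⟩
    exact hmul ha r

/-- If `M` embeds in a finite power of an isosimple module `U`, then it embeds in some finite
power of `U` which in turn embeds in `M`. -/
theorem exists_injective_injective {M : Type*} [AddCommGroup M] [Module R M]
    (h : IsIsosimple R U) (hM : ∃ (k : ℕ) (φ : M →ₗ[R] (Fin k → U)), Function.Injective φ) :
    ∃ (k : ℕ) (φ : M →ₗ[R] (Fin k → U)) (ψ : (Fin k → U) →ₗ[R] M),
      Function.Injective φ ∧ Function.Injective ψ := by
  classical
  obtain ⟨φ, hφ⟩ := Nat.find_spec hM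
  have hmin := fun m ↦ Nat.find_min hM (m := m)
  generalize Nat.find hM = k at φ hφ hmin
  -- `K i` is the kernel of `φ` with coordinate `i` dropped: nonzero by minimality of `k`, and
  -- embedded in `U` by coordinate `i`, hence a copy of `U`.
  let K : Fin k → Submodule R M := fun i ↦ ⨅ j ∈ ({i}ᶜ : Set (Fin k)),
    LinearMap.ker (LinearMap.proj j ∘ₗ φ)
  have hK (i : Fin k) (x : M) : x ∈ K i ↔ ∀ j, j ≠ i → φ x j = 0 := by
    simp [K]
  have hK0 (i : Fin k) : K i ≠ ⊥ := by
    intro hbot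
    obtain ⟨m, rfl⟩ : ∃ m, k = m + 1 := ⟨k - 1, by have := i.pos; omega⟩
    refine hmin m m.lt_succ_self ⟨LinearMap.funLeft R U i.succAbove ∘ₗ φ, ?_⟩
    refine LinearMap.ker_eq_bot.1 (eq_bot_iff.2 fun x hx ↦ ?_)
    rw [← hbot, hK]
    intro j hj
    obtain ⟨l, rfl⟩ := Fin.exists_succAbove_eq hj
    exact congrFun hx l
  have hinj (i : Fin k) (x : M) (hx : x ∈ K i) (hxi : φ x i = 0) : x = 0 := by
    apply hφ
    rw [map_zero]
    ext j
    by_cases hj : j = i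
    · rw [hj, hxi]; rfl
    · exact (hK i x).1 hx j hj
  have hE (i : Fin k) : Nonempty (U ≃ₗ[R] K i) := by
    let q : K i →ₗ[R] U := LinearMap.proj i ∘ₗ φ ∘ₗ (K i).subtype
    have hq : Function.Injective q := LinearMap.ker_eq_bot.1 <| eq_bot_iff.2 fun x hx ↦
      Subtype.ext (hinj i x x.2 hx)
    have hr : LinearMap.range q ≠ ⊥ := by
      intro hr
      rw [LinearMap.range_eq_bot] at hr
      refine hK0 i (eq_bot_iff.2 fun x hx ↦ ?_)
      exact congrArg Subtype.val (hq (a₁ := ⟨x, hx⟩) (a₂ := 0) (by simp [hr]))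
    obtain ⟨e⟩ := h.nonempty_equiv _ hr
    exact ⟨e.symm.trans (LinearEquiv.ofInjective q hq).symm⟩
  let e (i : Fin k) : U ≃ₗ[R] K i := (hE i).some
  refine ⟨k, φ, ∑ i, (K i).subtype ∘ₗ (e i).toLinearMap ∘ₗ LinearMap.proj i, hφ, ?_⟩
  refine LinearMap.ker_eq_bot.1 (eq_bot_iff.2 fun v hv ↦ ?_)
  have hv' : ∑ i, (e i (v i) : M) = 0 := by simpa using hv
  refine funext fun i ↦ ?_
  have h1 : φ (e i (v i)) i = 0 := by
    have h2 := congrFun (congrArg φ hv') i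
    rw [map_sum, Finset.sum_apply, Finset.sum_eq_single i] at h2
    · simpa using h2
    · intro j _ hj
      exact (hK j _).1 (e j (v j)).2 i hj.symm
    · simp
  have h3 : e i (v i) = 0 := Subtype.ext (hinj i _ (e i (v i)).2 h1)
  simpa using h3

end IsIsosimple

/-! ### From simple isoartinian rings to matrix rings -/

/-- A simple ring embeds, as a right module, in a finite power of each nonzero right ideal. -/
theorem IsSimpleRing.exists_injective_pi {R : Type*} [Ring R] [IsSimpleRing R]
    (U : Submodule Rᵐᵒᵖ R) (hU : U ≠ ⊥) :
    ∃ (k : ℕ) (φ : R →ₗ[Rᵐᵒᵖ] (Fin k → U)), Function.Injective φ := by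
  let J : Ideal R := Ideal.span (U : Set R)
  have hJ : J.IsTwoSided := by
    refine ⟨fun {a} b ha ↦ ?_⟩
    induction ha using Submodule.span_induction with
    | mem x hx => exact Ideal.subset_span (U.smul_mem (MulOpposite.op b) hx)
    | zero => simp
    | add x y _ _ hx hy => rw [add_mul]; exact J.add_mem hx hy
    | smul r x _ hx => rw [smul_mul_assoc]; exact J.smul_mem r hx
  have hJtop : J = ⊤ := by
    refine ((isSimpleRing_iff_isTwoSided_imp.1 ‹_›).2 J hJ).resolve_left fun hbot ↦ hU ?_
    refine eq_bot_iff.2 fun x hx ↦ ?_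
    have : x ∈ J := Ideal.subset_span hx
    simpa [hbot] using this
  have h1 : (1 : R) ∈ Submodule.span R (U : Set R) := (Ideal.eq_top_iff_one J).1 hJtop
  -- Since `1 = ∑ rᵢ uᵢ`, an `x` with all `uᵢ x = 0` vanishes.
  obtain ⟨k, r, u, hru⟩ := Submodule.mem_span_set'.1 h1
  let φ : R →ₗ[Rᵐᵒᵖ] (Fin k → U) := LinearMap.pi fun i ↦
    { toFun := fun x ↦ ⟨(u i : R) * x, U.smul_mem (MulOpposite.op x) (u i).2⟩
      map_add' := fun x y ↦ Subtype.ext (mul_add _ _ _)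
      map_smul' := fun s x ↦ Subtype.ext (mul_assoc (u i : R) x s.unop).symm }
  refine ⟨k, φ, LinearMap.ker_eq_bot.1 (eq_bot_iff.2 fun x hx ↦ ?_)⟩
  have hx' (i : Fin k) : (u i : R) * x = 0 := congrArg Subtype.val (congrFun hx i)
  rw [Submodule.mem_bot, ← one_mul x, ← hru, Finset.sum_mul]
  exact Finset.sum_eq_zero fun i _ ↦ by rw [smul_eq_mul, mul_assoc, hx', mul_zero]

/-- A ring, as a right module over itself, is the regular module of its opposite ring. -/
def MulOpposite.selfLinearEquiv (R : Type*) [Ring R] : R ≃ₗ[Rᵐᵒᵖ] Rᵐᵒᵖ where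
  toFun := MulOpposite.op
  invFun := MulOpposite.unop
  map_add' _ _ := rfl
  map_smul' _ _ := rfl
  left_inv _ := rfl
  right_inv _ := rfl

theorem IsSimpleRing.of_matrix {n : ℕ} (hn : 1 ≤ n) {D : Type*} [Ring D]
    (h : IsSimpleRing (Matrix (Fin n) (Fin n) D)) : IsSimpleRing D := by
  have : Nonempty (Fin n) := ⟨⟨0, hn⟩⟩
  exact ⟨TwoSidedIdeal.orderIsoMatrix (n := Fin n) (R := D) |>.isSimpleOrder⟩

theorem IsRightIsoartinianRing.exists_ringEquiv_matrix {R : Type u} [Ring R] [IsSimpleRing R]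
    (h : IsRightIsoartinianRing R) :
    ∃ (n : ℕ) (D : Type u) (_ : Ring D), 1 ≤ n ∧ IsSimpleRing D ∧
      IsPrincipalRightIdealDomain D ∧ Nonempty (R ≃+* Matrix (Fin n) (Fin n) D) := by
  obtain ⟨U, hU⟩ := IsIsoartinian.exists_isIsosimple h
  obtain ⟨k, φ, ψ, hφ, hψ⟩ := hU.exists_injective_injective <|
    IsSimpleRing.exists_injective_pi U (Submodule.nontrivial_iff_ne_bot.1 hU.nontrivial)
  obtain ⟨e⟩ := IsIsoartinian.nonempty_equiv_of_injective h φ ψ hφ hψ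
  have hk : 1 ≤ k := by
    rw [Nat.one_le_iff_ne_zero]
    rintro rfl
    exact zero_ne_one (e.injective (Subsingleton.elim (e 0) (e 1)))
  have hproj : Module.Projective Rᵐᵒᵖ (Fin k → U) :=
    Module.Projective.of_equiv ((MulOpposite.selfLinearEquiv R).symm.trans e)
  have hprojU : Module.Projective Rᵐᵒᵖ U :=
    Module.Projective.of_split (LinearMap.single Rᵐᵒᵖ (fun _ : Fin k ↦ U) ⟨0, hk⟩)
      (LinearMap.proj ⟨0, hk⟩) (LinearMap.proj_comp_single_same ..)
  let E : R ≃+* Matrix (Fin k) (Fin k) (Module.End Rᵐᵒᵖ U) :=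
    (RingEquiv.moduleEndSelfOp R).trans <| e.conjRingEquiv.trans (endVecRingEquivMatrixEnd ..)
  exact ⟨k, Module.End Rᵐᵒᵖ U, inferInstance, hk,
    IsSimpleRing.of_matrix hk (IsSimpleRing.of_ringEquiv E ‹_›),
    hU.isPrincipalRightIdealDomain_end, ⟨E⟩⟩

/-! ### Submodules of free modules over principal right ideal domains -/

/-- A linear surjection with a linear section splits its source. -/
def LinearMap.equivKerProd {S M Q : Type*} [Ring S] [AddCommGroup M] [Module S M]
    [AddCommGroup Q] [Module S Q] (p : M →ₗ[S] Q) (s : Q →ₗ[S] M) (hs : p ∘ₗ s = LinearMap.id) :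
    M ≃ₗ[S] LinearMap.ker p × Q :=
  have hps (q : Q) : p (s q) = q := LinearMap.congr_fun hs q
  { toFun := fun x ↦ (⟨x - s (p x), by simp [hps]⟩, p x)
    invFun := fun y ↦ y.1 + s y.2
    map_add' := fun x y ↦ Prod.ext (Subtype.ext (by simp; abel)) (by simp)
    map_smul' := fun c x ↦ Prod.ext (Subtype.ext (by simp [smul_sub])) (by simp)
    left_inv := fun x ↦ by simp
    right_inv := fun y ↦ by
      have hy : p y.1 = 0 := y.1.2
      exact Prod.ext (Subtype.ext (by simp [hps, hy])) (by simp [hps, hy]) }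

/-- The first coordinate maps `N` onto a projective submodule of `F`, so `N` splits, and the kernel
embeds in a smaller power of `F`. -/
theorem Submodule.exists_equiv_pi_of_forall {S F : Type*} [Ring S] [AddCommGroup F] [Module S F]
    [Module.Projective S F] (hF : ∀ N : Submodule S F, ∃ r : ℕ, Nonempty (N ≃ₗ[S] (Fin r → F)))
    (n : ℕ) (N : Submodule S (Fin n → F)) : ∃ r : ℕ, Nonempty (N ≃ₗ[S] (Fin r → F)) := by
  induction n with
  | zero =>
    have : Subsingleton N := ⟨fun x y ↦ Subtype.ext (Subsingleton.elim _ _)⟩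
    exact ⟨0, ⟨LinearEquiv.ofSubsingleton _ _⟩⟩
  | succ n ih =>
    let p : N →ₗ[S] F := LinearMap.proj 0 ∘ₗ N.subtype
    obtain ⟨s, ⟨e₁⟩⟩ := hF (LinearMap.range p)
    have : Module.Projective S (Fin s → F) :=
      Module.Projective.of_equiv (DFinsupp.linearEquivFunOnFintype (R := S) (M := fun _ : Fin s ↦ F))
    have : Module.Projective S (LinearMap.range p) := Module.Projective.of_equiv e₁.symm
    obtain ⟨t, ht⟩ := Module.projective_lifting_property p.rangeRestrict LinearMap.id
      p.surjective_rangeRestrict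
    let q : LinearMap.ker p.rangeRestrict →ₗ[S] (Fin n → F) :=
      LinearMap.funLeft S F Fin.succ ∘ₗ N.subtype ∘ₗ (LinearMap.ker p.rangeRestrict).subtype
    have hq : Function.Injective q := by
      intro x y hxy
      refine Subtype.ext (Subtype.ext (funext fun i ↦ ?_))
      refine Fin.cases ?_ (fun j ↦ congrFun hxy j) i
      exact congrArg Subtype.val (x.2.trans y.2.symm)
    obtain ⟨r, ⟨e₂⟩⟩ := ih (LinearMap.range q)
    refine ⟨r + s, ⟨(LinearMap.equivKerProd _ t ht).trans <|
      (((LinearEquiv.ofInjective q hq).trans e₂).prodCongr e₁).trans <|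
      (LinearEquiv.sumArrowLequivProdArrow (Fin r) (Fin s) S F).symm.trans
      (LinearEquiv.funCongrLeft S F finSumFinEquiv.symm)⟩⟩

namespace IsPrincipalRightIdealDomain

variable {D : Type*} [Ring D]

theorem exists_equiv_pi_of_rightIdeal (h : IsPrincipalRightIdealDomain D) (I : Submodule Dᵐᵒᵖ D) :
    ∃ r : ℕ, Nonempty (I ≃ₗ[Dᵐᵒᵖ] (Fin r → D)) := by
  have := h.isDomain
  obtain ⟨a, ha⟩ := h.principal I
  by_cases ha0 : a = 0
  · have : Subsingleton I := ⟨fun x y ↦ Subtype.ext <| by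
      obtain ⟨r, hr⟩ := (ha _).1 x.2
      obtain ⟨s, hs⟩ := (ha _).1 y.2
      rw [hr, hs, ha0, zero_mul, zero_mul]⟩
    exact ⟨0, ⟨LinearEquiv.ofSubsingleton _ _⟩⟩
  · let m : D →ₗ[Dᵐᵒᵖ] I :=
      { toFun := fun x ↦ ⟨a * x, (ha _).2 ⟨x, rfl⟩⟩
        map_add' := fun x y ↦ Subtype.ext (mul_add _ _ _)
        map_smul' := fun s x ↦ Subtype.ext (mul_assoc a x s.unop).symm }
    have hm : Function.Bijective m := by
      refine ⟨fun x y hxy ↦ mul_left_cancel₀ ha0 (congrArg Subtype.val hxy), fun y ↦ ?_⟩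
      obtain ⟨r, hr⟩ := (ha _).1 y.2
      exact ⟨r, Subtype.ext hr.symm⟩
    exact ⟨1, ⟨(LinearEquiv.ofBijective m hm).symm.trans
      (LinearEquiv.funUnique (Fin 1) Dᵐᵒᵖ D).symm⟩⟩

theorem isNoetherianRing_mulOpposite (h : IsPrincipalRightIdealDomain D) :
    IsNoetherianRing Dᵐᵒᵖ := by
  have : IsNoetherian Dᵐᵒᵖ D := ⟨fun I ↦ by
    obtain ⟨a, ha⟩ := h.principal I
    refine ⟨{a}, le_antisymm ?_ fun x hx ↦ ?_⟩
    · simpa using (ha a).2 ⟨1, (mul_one a).symm⟩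
    · obtain ⟨r, rfl⟩ := (ha x).1 hx
      exact Submodule.smul_mem _ (MulOpposite.op r) (Submodule.subset_span (by simp))⟩
  exact isNoetherian_of_linearEquiv (MulOpposite.selfLinearEquiv D)

theorem le_of_injective (h : IsPrincipalRightIdealDomain D) {r s : ℕ}
    (f : (Fin r → D) →ₗ[Dᵐᵒᵖ] (Fin s → D))
    (hf : Function.Injective f) : r ≤ s := by
  have := h.isDomain
  have := h.isNoetherianRing_mulOpposite
  let c (k : ℕ) : (Fin k → D) ≃ₗ[Dᵐᵒᵖ] (Fin k → Dᵐᵒᵖ) :=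
    LinearEquiv.piCongrRight fun _ ↦ MulOpposite.selfLinearEquiv D
  exact le_of_fin_injective Dᵐᵒᵖ ((c s).toLinearMap ∘ₗ f ∘ₗ (c r).symm.toLinearMap)
    ((c s).injective.comp (hf.comp (c r).symm.injective))

theorem isIsoartinian_pi (h : IsPrincipalRightIdealDomain D) (n : ℕ) :
    IsIsoartinian Dᵐᵒᵖ (Fin n → D) := by
  intro f hf
  have : Module.Projective Dᵐᵒᵖ D := Module.Projective.of_equiv (MulOpposite.selfLinearEquiv D).symm
  choose r e using fun i ↦
    Submodule.exists_equiv_pi_of_forall h.exists_equiv_pi_of_rightIdeal n (f i)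
  have hr : Antitone r := fun i j hij ↦
    h.le_of_injective ((e i).some.toLinearMap ∘ₗ Submodule.inclusion (hf hij) ∘ₗ
      (e j).some.symm.toLinearMap)
      ((e i).some.injective.comp
        ((Submodule.inclusion_injective (hf hij)).comp (e j).some.symm.injective))
  obtain ⟨m, hm⟩ := WellFoundedGT.monotone_chain_condition (α := ℕᵒᵈ) ⟨r, hr⟩
  refine ⟨m, fun i hi ↦ ?_⟩
  have hmi : r m = r i := hm i hi
  exact ⟨(e m).some.trans <| (LinearEquiv.funCongrLeft Dᵐᵒᵖ D (finCongr hmi.symm)).trans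
    (e i).some.symm⟩

end IsPrincipalRightIdealDomain

/-! ### Right ideals of matrix rings through columns -/

namespace Matrix

variable {R D : Type*} [Ring R] [Ring D] {n : ℕ}

/-- The right `D`-module of the columns of the matrices in a right ideal of a ring identified
with a matrix ring over `D`. -/
def columnSubmodule (e : R ≃+* Matrix (Fin n) (Fin n) D) (I : Submodule Rᵐᵒᵖ R) :
    Submodule Dᵐᵒᵖ (Fin n → D) where
  carrier := {v | e.symm (of fun i _ ↦ v i) ∈ I}
  zero_mem' := by
    have : (of fun (i _ : Fin n) ↦ (0 : Fin n → D) i) = 0 := rfl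
    rw [Set.mem_ofPred, this, map_zero]
    exact I.zero_mem
  add_mem' {v w} hv hw := by
    have : (of fun (i _ : Fin n) ↦ (v + w) i) = (of fun i _ ↦ v i) + (of fun i _ ↦ w i) := rfl
    rw [Set.mem_ofPred, this, map_add]
    exact I.add_mem hv hw
  smul_mem' c v hv := by
    have : (of fun (i _ : Fin n) ↦ (c • v) i) =
        (of fun i _ ↦ v i) * (diagonal fun _ ↦ c.unop : Matrix (Fin n) (Fin n) D) := by
      ext i j
      simp [mul_diagonal]
    rw [Set.mem_ofPred, this, map_mul]
    exact I.smul_mem (MulOpposite.op (e.symm (diagonal fun _ ↦ c.unop))) hv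

theorem mem_iff_col_mem (e : R ≃+* Matrix (Fin n) (Fin n) D) (I : Submodule Rᵐᵒᵖ R)
    (x : R) : x ∈ I ↔ ∀ j, (e x).col j ∈ columnSubmodule e I := by
  constructor
  · intro hx j
    -- Right multiplication by the matrix whose row `j` is all ones copies column `j` everywhere.
    have : (of fun (i _ : Fin n) ↦ (e x).col j i) = e x * of fun i _ ↦ if i = j then 1 else 0 := by
      ext i k
      simp [mul_apply]
    change e.symm _ ∈ I
    rw [this, map_mul, e.symm_apply_apply]
    exact I.smul_mem (MulOpposite.op _) hx
  · intro hx
    have : x = ∑ j, e.symm (of fun (i _ : Fin n) ↦ (e x).col j i) * e.symm (single j j 1) := by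
      apply e.injective
      simp only [map_sum, map_mul, e.apply_symm_apply]
      ext i k
      simp [sum_apply, mul_apply, single_apply, ite_and]
    rw [this]
    exact I.sum_mem fun j _ ↦ I.smul_mem (MulOpposite.op _) (hx j)

/-- The columns of an element of a right ideal. -/
def columns (e : R ≃+* Matrix (Fin n) (Fin n) D) {I : Submodule Rᵐᵒᵖ R} (x : I) (j : Fin n) :
    columnSubmodule e I :=
  ⟨(e x).col j, (mem_iff_col_mem e I x).1 x.2 j⟩

/-- The element of a right ideal with given columns. -/
def ofColumns (e : R ≃+* Matrix (Fin n) (Fin n) D) {I : Submodule Rᵐᵒᵖ R}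
    (w : Fin n → columnSubmodule e I) : I :=
  ⟨e.symm (of fun i j ↦ (w j).1 i), (mem_iff_col_mem e I _).2 fun j ↦ by
    rw [e.apply_symm_apply]
    exact (w j).2⟩

theorem ofColumns_columns (e : R ≃+* Matrix (Fin n) (Fin n) D) {I : Submodule Rᵐᵒᵖ R} (x : I) :
    ofColumns e (columns e x) = x :=
  Subtype.ext (e.symm_apply_apply _)

theorem columns_ofColumns (e : R ≃+* Matrix (Fin n) (Fin n) D) {I : Submodule Rᵐᵒᵖ R}
    (w : Fin n → columnSubmodule e I) : columns e (ofColumns e w) = w := by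
  refine funext fun j ↦ Subtype.ext (funext fun i ↦ ?_)
  exact congrFun (congrFun (e.apply_symm_apply (of fun i j ↦ (w j).1 i)) i) j

theorem columns_add (e : R ≃+* Matrix (Fin n) (Fin n) D) {I : Submodule Rᵐᵒᵖ R} (x y : I) :
    columns e (x + y) = columns e x + columns e y := by
  refine funext fun j ↦ Subtype.ext (funext fun i ↦ ?_)
  simp [columns]

/-- Right multiplication recombines columns with coefficients in `D`, so a `D`-linear map applied to
each column is `R`-linear. -/
theorem columns_smul (e : R ≃+* Matrix (Fin n) (Fin n) D) {I : Submodule Rᵐᵒᵖ R} (c : Rᵐᵒᵖ)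
    (x : I) (j : Fin n) :
    columns e (c • x) j = ∑ k, MulOpposite.op (e c.unop k j) • columns e x k := by
  refine Subtype.ext (funext fun l ↦ ?_)
  have : ((c • x : I) : R) = x * c.unop := rfl
  simp [this, columns, mul_apply]

theorem columns_injective (e : R ≃+* Matrix (Fin n) (Fin n) D) {I : Submodule Rᵐᵒᵖ R} :
    Function.Injective (columns e (I := I)) :=
  Function.LeftInverse.injective (ofColumns_columns e)

/-- A linear isomorphism between column modules, applied to each column. -/
def mapColumns (e : R ≃+* Matrix (Fin n) (Fin n) D) {I J : Submodule Rᵐᵒᵖ R}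
    (φ : columnSubmodule e I ≃ₗ[Dᵐᵒᵖ] columnSubmodule e J) : I ≃ₗ[Rᵐᵒᵖ] J where
  toFun x := ofColumns e fun j ↦ φ (columns e x j)
  invFun y := ofColumns e fun j ↦ φ.symm (columns e y j)
  map_add' x y := columns_injective e <| by
    simp only [columns_add, columns_ofColumns, Pi.add_apply, map_add]
    rfl
  map_smul' c x := columns_injective e <| funext fun j ↦ by
    simp only [columns_smul, columns_ofColumns, map_sum, map_smul, RingHom.id_apply]
  left_inv x := by simp [columns_ofColumns, ofColumns_columns]
  right_inv y := by simp [columns_ofColumns, ofColumns_columns]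

end Matrix

theorem IsPrincipalRightIdealDomain.isRightIsoartinianRing_of_ringEquiv {R D : Type*} [Ring R]
    [Ring D] (h : IsPrincipalRightIdealDomain D) {n : ℕ} (e : R ≃+* Matrix (Fin n) (Fin n) D) :
    IsRightIsoartinianRing R := by
  intro f hf
  obtain ⟨m, hm⟩ := h.isIsoartinian_pi n (fun i ↦ Matrix.columnSubmodule e (f i))
    fun i j hij v hv ↦ hf hij hv
  exact ⟨m, fun i hi ↦ (hm i hi).elim fun φ ↦ ⟨Matrix.mapColumns e φ⟩⟩

theorem mainTheorem6 (R : Type u) [Ring R] [IsSimpleRing R] :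
    (IsRightIsoartinianRing R ↔
      ∃ (n : ℕ) (D : Type u) (_ : Ring D), 1 ≤ n ∧ IsSimpleRing D ∧
        IsPrincipalRightIdealDomain D ∧ Nonempty (R ≃+* Matrix (Fin n) (Fin n) D)) ∧
    (∀ (n : ℕ) (D : Type v) [DivisionRing D], 1 ≤ n →
      Nonempty (R ≃+* Matrix (Fin n) (Fin n) D) →
        (IsSimpleRing R ∧ IsArtinianRing R) ∧ IsArtinian Rᵐᵒᵖ R ∧ IsNoetherian Rᵐᵒᵖ R) := by
  refine ⟨⟨fun h ↦ h.exists_ringEquiv_matrix, ?_⟩, ?_⟩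
  · rintro ⟨n, D, _, -, -, hD, ⟨e⟩⟩
    exact hD.isRightIsoartinianRing_of_ringEquiv e
  · rintro n D _ - ⟨e⟩
    -- Semisimplicity passes to the opposite ring, giving the chain conditions on the right.
    have : IsSemisimpleRing R := e.symm.isSemisimpleRing
    exact ⟨⟨‹_›, inferInstance⟩, isArtinian_of_linearEquiv (MulOpposite.selfLinearEquiv R).symm,
      isNoetherian_of_linearEquiv (MulOpposite.selfLinearEquiv R).symm⟩
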